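/- Let $a_0,\dots,a_6$ be nonzero parameters with chosen cube roots $a_j^{1/3}\in\mathbb C^\times$ (all fractional powers below are monomials in these), put $q=a_0a_1a_2^2a_3^3a_4^2a_5a_6^2$, $a=(a_0a_1a_5)^{1/3}$, $b=(a_2a_4a_6q)^{1/3}$, where $q^{1/3}=(a_0a_1a_2^2a_3^3a_4^2a_5a_6^2)^{1/3}$, and suppose $|q|<1$. Let $\tau_1,\dots,\tau_9$ be indeterminates. Let $(C_{ij})$ be the Cartan matrix of type $E_6^{(1)}$, with nodes $0,\dots,6$ and Dynkin diagram edges $1\!-\!2,\ 2\!-\!3,\ 3\!-\!4,\ 4\!-\!5,\ 3\!-\!6,\ 6\!-\!0$. Let $s_0,\dots,s_6$ act on functions of $(a_0^{1/3},\dots,a_6^{1/3};\tau_1,\dots,\tau_9)$, rational in the $\tau_k$, as ring homomorphisms by $s_i(a_j^{1/3})=a_j^{1/3}(a_i^{1/3})^{-C_{ij}}$ and $$s_1:\tau_5\leftrightarrow\tau_6,\quad s_2:\tau_4\leftrightarrow\tau_5,\quad s_4:\tau_7\leftrightarrow\tau_8,\quad s_5:\tau_8\leftrightarrow\tau_9,\quad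 s_6:\tau_1\leftrightarrow\tau_2,\quad s_0:\tau_2\leftrightarrow\tau_3,$$ $$s_3(\tau_1)=\frac{x+a_3^{-1}y+a_3z}{\tau_4\tau_7},\quad s_3(\tau_4)=\frac{a_3x+y+a_3^{-1}z}{\tau_1\tau_7},\quad s_3(\tau_7)=\frac{a_3^{-1}x+a_3y+z}{\tau_1\tau_4},$$ all other $\tau_k$ being fixed, where $$x=\Big(\tfrac{a_1a_2^2}{a_4^2a_5}\Big)^{1/3}\tau_1\tau_2\tau_3,\quad y=\Big(\tfrac{a_4^2a_5}{a_0a_6^2}\Big)^{1/3}\tau_4\tau_5\tau_6,\quad z=\Big(\tfrac{a_0a_6^2}{a_1a_2^2}\Big)^{1/3}\tau_7\tau_8\tau_9 .$$ Products of transformations are applied from left to right (the leftmost factor first). Put $r_{147}=s_3$, $r_{258}=s_2s_4s_6\,r_{147}\,s_2s_4s_6$, $r_{369}=s_0s_1s_5\,r_{258}\,s_0s_1s_5$, and define the translations $$\ell_1=r_{258}r_{369}r_{258}r_{147},\qquad \ell_2=r_{369}r_{147}r_{369}r_{258},\qquad \ell_3=r_{147}r_{258}r_{147}r_{369}.$$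 They act by $\ell_1(a,b)=(a,q^{-1}b)$, $\ell_2(a,b)=(q^{-1}a,qb)$, $\ell_3(a,b)=(qa,b)$. With $(x;p,p)_\infty=\prod_{i,j\ge0}(1-xp^{i+j})$ and $(x_1,\dots,x_r;p,p)_\infty=\prod_k(x_k;p,p)_\infty$, let $$N(a,b)=\frac{\left(-\frac{aq}{b},-ab^2q,-\frac{q}{a^2b};q,q\right)_\infty\left(\frac{b^3q^3}{a^3},\frac{q^3}{a^3b^6},a^6b^3q^3;q^3,q^3\right)_\infty}{\left(\frac{b^2q^2}{a^2},\frac{q^2}{a^2b^4},a^4b^2q^2;q^2,q^2\right)_\infty},$$ and define the normalized $\tau$-functions $$(U_1,U_2,U_3)=\frac{(\tau_1,\tau_4,\tau_7)}{N(a,b)},\quad (V_1,V_2,V_3)=\frac{(\tau_2,\tau_5,\tau_8)}{N(q^{1/3}a,q^{-2/3}b)},\quad (W_1,W_2,W_3)=\frac{(\tau_3,\tau_6,\tau_9)}{N(q^{-1/3}a,q^{-1/3}b)} .$$ **Proposition.** For every $i\in\mathbb Z/3\mathbb Z$, $$ab\,U_i\,\ell_1(U_{i+1})-\frac qb\,\ell_1(U_i)\,U_{i+1}=\gamma_i\Big(ab-\frac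 qb\Big)V_{i+2}W_{i+2},$$ $$\frac1b\,V_i\,\ell_2(V_{i+1})-\frac1a\,\ell_2(V_i)\,V_{i+1}=\delta_i\Big(\frac1b-\frac1a\Big)W_{i+2}U_{i+2},$$ $$\frac1a\,W_i\,\ell_3(W_{i+1})-ab\,\ell_3(W_i)\,W_{i+1}=\epsilon_i\Big(\frac1a-ab\Big)U_{i+2}V_{i+2},$$ where $$\gamma_1=\Big(\tfrac{a_0a_6^2}{a_1a_2^2}\Big)^{1/3},\quad \gamma_2=\Big(\tfrac{a_1a_2^2}{a_4^2a_5}\Big)^{1/3},\quad \gamma_3=\Big(\tfrac{a_4^2a_5}{a_0a_6^2}\Big)^{1/3},$$ $$\delta_1=\Big(\tfrac{a_0a_2}{a_1a_6}\Big)^{1/3},\quad \delta_2=\Big(\tfrac{a_1a_4}{a_2a_5}\Big)^{1/3},\quad \delta_3=\Big(\tfrac{a_5a_6}{a_0a_4}\Big)^{1/3},$$ $$\epsilon_1=\Big(\tfrac{a_1^2a_2}{a_0^2a_6}\Big)^{1/3},\quad \epsilon_2=\Big(\tfrac{a_4a_5^2}{a_1^2a_2}\Big)^{1/3},\quad \epsilon_3=\Big(\tfrac{a_0^2a_6}{a_4a_5^2}\Big)^{1/3}.$$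 Each equation is an identity in $\mathbb C(\tau_1,\dots,\tau_9)$ at every parameter point $(a_j^{1/3})\in(\mathbb C^\times)^7$ with $|q|<1$ at which the normalization factors of the $U$, $V$, $W$, and the $\ell_k$-translate of the normalization factor to which $\ell_k$ is applied in that equation, have neither a zero nor a pole (for each of these values of $N$, both the numerator and the denominator products in the displayed formula are nonzero). This system of equations is called the bilinear form of the $q$-Painlevé equation of type $E_6^{(1)}$. -/

import Mathlib

noncomputable section

namespace QPE6

open MvPolynomial

/-! ### Parameters and the field of tau-functions -/

/-- A point of the parameter space. The component `α j` is the cube root `a_j^{1/3}` of the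
multiplicative root variable `a_j` (`j = 0, …, 6`). -/
abbrev Param : Type := Fin 7 → ℂˣ

/-- The field `ℂ(τ₁, …, τ₉)` of rational functions in nine indeterminates. The indices `1, …, 9`
are read in `Fin 9`, so `9` is the element `0` of `Fin 9`. -/
abbrev TauField : Type := FractionRing (MvPolynomial (Fin 9) ℂ)

/-- The indeterminate `τ_k`. -/
def tauVar (k : Fin 9) : TauField := algebraMap (MvPolynomial (Fin 9) ℂ) TauField (X k)

/-- The ring in which all identities take place: families, indexed by the parameter
point `a^{1/3}`, of rational functions of `τ₁, …, τ₉`. It contains the `τ_k` (constant families),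
the functions of `a^{1/3}` (families of constants), and all products of these. -/
abbrev Fun : Type := Param → TauField

/-- A function of the parameters `a^{1/3}`, as an element of `Fun`. -/
def ofCoeff (c : Param → ℂ) : Fun := fun α => algebraMap ℂ TauField (c α)

/-- The indeterminate `τ_k`, as an element of `Fun`. -/
def tau (k : Fin 9) : Fun := fun _ => tauVar k

/-! ### The simple reflections of the affine Weyl group of type `E₆⁽¹⁾` -/

/-- The Cartan matrix of type `E₆⁽¹⁾`; the Dynkin diagram has the edges
`1-2, 2-3, 3-4, 4-5, 3-6, 6-0`. -/
def cartan : Matrix (Fin 7) (Fin 7) ℤ :=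
  !![ 2,  0,  0,  0,  0,  0, -1;
      0,  2, -1,  0,  0,  0,  0;
      0, -1,  2, -1,  0,  0,  0;
      0,  0, -1,  2, -1,  0, -1;
      0,  0,  0, -1,  2, -1,  0;
      0,  0,  0,  0, -1,  2,  0;
     -1,  0,  0, -1,  0,  0,  2]

/-- `s_i(a_j) = a_j a_i^{-C_ij}`, on cube roots. -/
def reflParam (i : Fin 7) (α : Param) : Param := fun j => α j * α i ^ (-cartan i j)

/-- `c_x = a₁^{1/3} a₂^{2/3} a₄^{-2/3} a₅^{-1/3}`. -/
def cx (α : Param) : ℂˣ := α 1 * α 2 ^ 2 * (α 4 ^ 2)⁻¹ * (α 5)⁻¹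

/-- `c_y = a₅^{1/3} a₄^{2/3} a₆^{-2/3} a₀^{-1/3}`. -/
def cy (α : Param) : ℂˣ := α 5 * α 4 ^ 2 * (α 6 ^ 2)⁻¹ * (α 0)⁻¹

/-- `c_z = a₀^{1/3} a₆^{2/3} a₂^{-2/3} a₁^{-1/3}`. -/
def cz (α : Param) : ℂˣ := α 0 * α 6 ^ 2 * (α 2 ^ 2)⁻¹ * (α 1)⁻¹

/-- `u x' + v y' + w z'` with `x' = c_x τ₁τ₂τ₃`, `y' = c_y τ₄τ₅τ₆`, `z' = c_z τ₇τ₈τ₉`. -/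
def linForm (α : Param) (u v w : ℂˣ) : TauField :=
  algebraMap ℂ TauField ↑(u * cx α) * (tauVar 1 * tauVar 2 * tauVar 3) +
  algebraMap ℂ TauField ↑(v * cy α) * (tauVar 4 * tauVar 5 * tauVar 6) +
  algebraMap ℂ TauField ↑(w * cz α) * (tauVar 7 * tauVar 8 * tauVar 9)

/-- The permutations of the `τ_k` induced by `s_i`, `i ≠ 3` (the entry at `3` is not used). -/
def tauPerm : Fin 7 → Equiv.Perm (Fin 9) :=
  ![Equiv.swap 2 3, Equiv.swap 5 6, Equiv.swap 4 5, 1, Equiv.swap 7 8, Equiv.swap 8 9,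
    Equiv.swap 1 2]

/-- The value `s_i(τ_k)` at the parameter point `α`; recall `a₃ = (α 3)³`. -/
def reflTau (i : Fin 7) (α : Param) (k : Fin 9) : TauField :=
  if i = 3 then
    if k = 1 then linForm α 1 ((α 3 ^ 3)⁻¹) (α 3 ^ 3) / (tauVar 4 * tauVar 7)
    else if k = 4 then linForm α (α 3 ^ 3) 1 ((α 3 ^ 3)⁻¹) / (tauVar 1 * tauVar 7)
    else if k = 7 then linForm α ((α 3 ^ 3)⁻¹) (α 3 ^ 3) 1 / (tauVar 1 * tauVar 4)
    else tauVar k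
  else tauVar (tauPerm i k)

theorem tauVar_ne_zero (k : Fin 9) : tauVar k ≠ 0 := by
  unfold tauVar
  rw [Ne, FaithfulSMul.algebraMap_eq_zero_iff]
  exact X_ne_zero k

theorem linForm_ne_zero (α : Param) (u v w : ℂˣ) : linForm α u v w ≠ 0 := by
  have h : linForm α u v w = algebraMap (MvPolynomial (Fin 9) ℂ) TauField
      (C ((u * cx α : ℂˣ) : ℂ) * (X 1 * X 2 * X 3) + C ((v * cy α : ℂˣ) : ℂ) * (X 4 * X 5 * X 6) +
        C ((w * cz α : ℂˣ) : ℂ) * (X 7 * X 8 * X 9)) := by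
    simp only [linForm, tauVar, map_add, map_mul,
      IsScalarTower.algebraMap_apply ℂ (MvPolynomial (Fin 9) ℂ) TauField, algebraMap_eq]
  rw [h, Ne, FaithfulSMul.algebraMap_eq_zero_iff]
  intro h0
  have h1 := congrArg (eval (![0, 1, 1, 1, 0, 0, 0, 0, 0] : Fin 9 → ℂ)) h0
  have e1 : (![0, 1, 1, 1, 0, 0, 0, 0, 0] : Fin 9 → ℂ) 1 = 1 := rfl
  have e2 : (![0, 1, 1, 1, 0, 0, 0, 0, 0] : Fin 9 → ℂ) 2 = 1 := rfl
  have e3 : (![0, 1, 1, 1, 0, 0, 0, 0, 0] : Fin 9 → ℂ) 3 = 1 := rfl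
  have e4 : (![0, 1, 1, 1, 0, 0, 0, 0, 0] : Fin 9 → ℂ) 4 = 0 := rfl
  have e7 : (![0, 1, 1, 1, 0, 0, 0, 0, 0] : Fin 9 → ℂ) 7 = 0 := rfl
  rw [map_zero] at h1
  simp only [map_add, map_mul, eval_C, eval_X, e1, e2, e3, e4, e7, zero_mul, mul_zero, add_zero,
    mul_one] at h1
  exact (u * cx α).ne_zero h1

theorem refl_identity {F : Type*} [Field F] (A x y z t1 t4 t7 X' Y' Z' P1 P4 P7 : F)
    (hA : A ≠ 0) (h1 : t1 ≠ 0) (h4 : t4 ≠ 0) (h7 : t7 ≠ 0)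
    (hx : X' = x * t1) (hy : Y' = y * t4) (hz : Z' = z * t7)
    (hP1 : P1 = X' + A⁻¹ * Y' + A * Z') (hP4 : P4 = A * X' + Y' + A⁻¹ * Z')
    (hP7 : P7 = A⁻¹ * X' + A * Y' + Z') (h40 : P4 ≠ 0) (h70 : P7 ≠ 0) :
    t1 = (x * (P1 / (t4 * t7)) + A * y * (P4 / (t1 * t7)) + A⁻¹ * z * (P7 / (t1 * t4))) /
      ((P4 / (t1 * t7)) * (P7 / (t1 * t4))) := by
  have hne : (P4 / (t1 * t7)) * (P7 / (t1 * t4)) ≠ 0 :=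
    mul_ne_zero (div_ne_zero h40 (mul_ne_zero h1 h7)) (div_ne_zero h70 (mul_ne_zero h1 h4))
  rw [eq_div_iff hne]
  have key : P4 * P7 = X' * P1 + A * Y' * P4 + A⁻¹ * Z' * P7 := by
    rw [hP1, hP4, hP7]; field_simp; ring
  have e1 : t1 * (P4 / (t1 * t7) * (P7 / (t1 * t4))) = P4 * P7 / (t1 * t4 * t7) := by
    field_simp
  have e2 : x * (P1 / (t4 * t7)) + A * y * (P4 / (t1 * t7)) + A⁻¹ * z * (P7 / (t1 * t4)) =
      (X' * P1 + A * Y' * P4 + A⁻¹ * Z' * P7) / (t1 * t4 * t7) := by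
    rw [hx, hy, hz]; field_simp
  rw [e1, e2, key]

theorem aeval_injective_of_generates (σ : Fin 9 → TauField)
    (h : ∀ k, tauVar k ∈ IntermediateField.adjoin ℂ (Set.range σ)) :
    Function.Injective (aeval σ : MvPolynomial (Fin 9) ℂ →ₐ[ℂ] TauField) := by
  have htop : IntermediateField.adjoin ℂ (Set.range σ) = ⊤ := by
    rw [eq_top_iff]
    intro x _
    have hp : ∀ p : MvPolynomial (Fin 9) ℂ, algebraMap (MvPolynomial (Fin 9) ℂ) TauField p ∈
        IntermediateField.adjoin ℂ (Set.range σ) := by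
      intro p
      induction p using MvPolynomial.induction_on with
      | C c =>
        have : algebraMap (MvPolynomial (Fin 9) ℂ) TauField (C c) = algebraMap ℂ TauField c := by
          rw [IsScalarTower.algebraMap_apply ℂ (MvPolynomial (Fin 9) ℂ) TauField]; rfl
        rw [this]; exact IntermediateField.algebraMap_mem _ c
      | add p q hp hq => rw [map_add]; exact add_mem hp hq
      | mul_X p k hp => rw [map_mul]; exact mul_mem hp (h k)
    obtain ⟨p, r, -, rfl⟩ := IsFractionRing.div_surjective (MvPolynomial (Fin 9) ℂ) x
    exact div_mem (hp p) (hp r)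
  have halg : Algebra.IsAlgebraic (Algebra.adjoin ℂ (Set.range σ)) TauField := by
    refine ⟨fun x => ?_⟩
    have hx : x ∈ IntermediateField.adjoin ℂ (Set.range σ) := htop ▸ IntermediateField.mem_top
    rw [IntermediateField.mem_adjoin_iff_div] at hx
    obtain ⟨r, hr, s, hs, rfl⟩ := hx
    exact (isAlgebraic_algebraMap (⟨r, hr⟩ : Algebra.adjoin ℂ (Set.range σ))).mul
      (isAlgebraic_algebraMap (⟨s, hs⟩ : Algebra.adjoin ℂ (Set.range σ))).inv
  have hind : AlgebraicIndependent ℂ tauVar := by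
    have he : (aeval tauVar : MvPolynomial (Fin 9) ℂ →ₐ[ℂ] TauField) =
        Algebra.algHom ℂ (MvPolynomial (Fin 9) ℂ) TauField := by
      ext k; simp [tauVar, Algebra.algHom]
    rw [AlgebraicIndependent, he]
    exact IsFractionRing.injective (MvPolynomial (Fin 9) ℂ) TauField
  exact (Algebra.IsAlgebraic.isTranscendenceBasis_of_le_trdeg_of_finite ℂ σ
    hind.cardinalMk_le_trdeg).1

theorem reflTau_injective (i : Fin 7) (α : Param) :
    Function.Injective (aeval (reflTau i α) : MvPolynomial (Fin 9) ℂ →ₐ[ℂ] TauField) := by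
  apply aeval_injective_of_generates
  intro k
  have hm : ∀ k, reflTau i α k ∈ IntermediateField.adjoin ℂ (Set.range (reflTau i α)) :=
    fun k => IntermediateField.subset_adjoin ℂ _ ⟨k, rfl⟩
  by_cases hi : i = 3
  · subst hi
    set E := IntermediateField.adjoin ℂ (Set.range (reflTau 3 α)) with hE
    have h2 : tauVar 2 ∈ E := hm 2
    have h3 : tauVar 3 ∈ E := hm 3
    have h5 : tauVar 5 ∈ E := hm 5
    have h6 : tauVar 6 ∈ E := hm 6
    have h8 : tauVar 8 ∈ E := hm 8
    have h9 : tauVar 9 ∈ E := hm 9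
    have g1 : linForm α 1 ((α 3 ^ 3)⁻¹) (α 3 ^ 3) / (tauVar 4 * tauVar 7) ∈ E := hm 1
    have g4 : linForm α (α 3 ^ 3) 1 ((α 3 ^ 3)⁻¹) / (tauVar 1 * tauVar 7) ∈ E := hm 4
    have g7 : linForm α ((α 3 ^ 3)⁻¹) (α 3 ^ 3) 1 / (tauVar 1 * tauVar 4) ∈ E := hm 7
    set A : TauField := algebraMap ℂ TauField ↑(α 3 ^ 3) with hA
    have hA0 : A ≠ 0 := by rw [hA]; simp
    have hAE : A ∈ E := E.algebraMap_mem _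
    have hxE : algebraMap ℂ TauField ↑(cx α) * tauVar 2 * tauVar 3 ∈ E :=
      mul_mem (mul_mem (E.algebraMap_mem _) h2) h3
    have hyE : algebraMap ℂ TauField ↑(cy α) * tauVar 5 * tauVar 6 ∈ E :=
      mul_mem (mul_mem (E.algebraMap_mem _) h5) h6
    have hzE : algebraMap ℂ TauField ↑(cz α) * tauVar 8 * tauVar 9 ∈ E :=
      mul_mem (mul_mem (E.algebraMap_mem _) h8) h9
    set x := algebraMap ℂ TauField ↑(cx α) * tauVar 2 * tauVar 3 with hx
    set y := algebraMap ℂ TauField ↑(cy α) * tauVar 5 * tauVar 6 with hy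
    set z := algebraMap ℂ TauField ↑(cz α) * tauVar 8 * tauVar 9 with hz
    have hP1 : linForm α 1 ((α 3 ^ 3)⁻¹) (α 3 ^ 3) =
        x * tauVar 1 + A⁻¹ * (y * tauVar 4) + A * (z * tauVar 7) := by
      simp only [linForm, hx, hy, hz, hA, Units.val_mul, Units.val_inv_eq_inv_val, map_mul,
        map_inv₀, Units.val_one, map_one]
      ring
    have hP4 : linForm α (α 3 ^ 3) 1 ((α 3 ^ 3)⁻¹) =
        A * (x * tauVar 1) + y * tauVar 4 + A⁻¹ * (z * tauVar 7) := by
      simp only [linForm, hx, hy, hz, hA, Units.val_mul, Units.val_inv_eq_inv_val, map_mul,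
        map_inv₀, Units.val_one, map_one]
      ring
    have hP7 : linForm α ((α 3 ^ 3)⁻¹) (α 3 ^ 3) 1 =
        A⁻¹ * (x * tauVar 1) + A * (y * tauVar 4) + z * tauVar 7 := by
      simp only [linForm, hx, hy, hz, hA, Units.val_mul, Units.val_inv_eq_inv_val, map_mul,
        map_inv₀, Units.val_one, map_one]
      ring
    have n1 := linForm_ne_zero α 1 ((α 3 ^ 3)⁻¹) (α 3 ^ 3)
    have n4 := linForm_ne_zero α (α 3 ^ 3) 1 ((α 3 ^ 3)⁻¹)
    have n7 := linForm_ne_zero α ((α 3 ^ 3)⁻¹) (α 3 ^ 3) 1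
    have t1 := tauVar_ne_zero 1
    have t4 := tauVar_ne_zero 4
    have t7 := tauVar_ne_zero 7
    have h1 : tauVar 1 ∈ E := by
      rw [refl_identity A x y z _ _ _ _ _ _ _ _ _ hA0 t1 t4 t7 rfl rfl rfl hP1 hP4 hP7 n4 n7]
      exact div_mem (add_mem (add_mem (mul_mem hxE g1) (mul_mem (mul_mem hAE hyE) g4))
        (mul_mem (mul_mem (inv_mem hAE) hzE) g7)) (mul_mem g4 g7)
    have h4 : tauVar 4 ∈ E := by
      have := refl_identity A y z x _ _ _ _ _ _ _ _ _ hA0 t4 t7 t1 rfl rfl rfl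
        (hP4.trans (by ring)) (hP7.trans (by ring)) (hP1.trans (by ring)) n7 n1
      rw [this, mul_comm (tauVar 7) (tauVar 1), mul_comm (tauVar 4) (tauVar 1),
        mul_comm (tauVar 4) (tauVar 7)]
      rw [mul_comm (tauVar 4) (tauVar 7)] at g1
      exact div_mem (add_mem (add_mem (mul_mem hyE g4) (mul_mem (mul_mem hAE hzE) g7))
        (mul_mem (mul_mem (inv_mem hAE) hxE) g1)) (mul_mem g7 g1)
    have h7 : tauVar 7 ∈ E := by
      have := refl_identity A z x y _ _ _ _ _ _ _ _ _ hA0 t7 t1 t4 rfl rfl rfl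
        (hP7.trans (by ring)) (hP1.trans (by ring)) (hP4.trans (by ring)) n1 n4
      rw [this, mul_comm (tauVar 7) (tauVar 4), mul_comm (tauVar 7) (tauVar 1)]
      exact div_mem (add_mem (add_mem (mul_mem hzE g7) (mul_mem (mul_mem hAE hxE) g1))
        (mul_mem (mul_mem (inv_mem hAE) hyE) g4)) (mul_mem g1 g4)
    fin_cases k
    exacts [h9, h1, h2, h3, h4, h5, h6, h7, h8]
  · have := hm ((tauPerm i).symm k)
    simpa [reflTau, hi] using this

/-- The substitution `τ_k ↦ s_i(τ_k)` (at the parameter point `α`), as an endomorphism of the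
field `ℂ(τ₁, …, τ₉)`. -/
def reflSubst (i : Fin 7) (α : Param) : TauField →ₐ[ℂ] TauField :=
  IsFractionRing.liftAlgHom (reflTau_injective i α)

/-- The simple reflection `s_i` acting on functions of `(a^{1/3}; τ₁, …, τ₉)`: it acts on the
parameters through `s_i(a_j) = a_j a_i^{-C_ij}` and on the indeterminates through `s_i(τ_k)`. -/
def s (i : Fin 7) : Fun →+* Fun :=
  RingHom.pi fun α =>
    (reflSubst i α : TauField →+* TauField).comp (Pi.evalRingHom _ (reflParam i α))

/-! ### Translations

Products of transformations act from left to right: in `w₁ w₂ ⋯ w_n` the transformation `w₁` is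
applied first. -/

/-- The product `w₁ w₂ ⋯ w_n`. -/
def word : List (Fun →+* Fun) → (Fun →+* Fun)
  | [] => RingHom.id Fun
  | w :: ws => (word ws).comp w

/-- The reflection in the root `α₁₄₇ = α₃`. -/
def r147 : Fun →+* Fun := s 3

/-- The reflection in the root `α₂₅₈`, the image of `α₁₄₇` under `s₂ s₄ s₆`. -/
def r258 : Fun →+* Fun := word [s 2, s 4, s 6, r147, s 2, s 4, s 6]

/-- The reflection in the root `α₃₆₉`, the image of `α₂₅₈` under `s₀ s₁ s₅`. -/
def r369 : Fun →+* Fun := word [s 0, s 1, s 5, r258, s 0, s 1, s 5]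

/-- The translation `ℓ₁ = r₂₅₈ r₃₆₉ r₂₅₈ r₁₄₇`. -/
def ell1 : Fun →+* Fun := word [r258, r369, r258, r147]

/-- The translation `ℓ₂ = r₃₆₉ r₁₄₇ r₃₆₉ r₂₅₈`. -/
def ell2 : Fun →+* Fun := word [r369, r147, r369, r258]

/-- The translation `ℓ₃ = r₁₄₇ r₂₅₈ r₁₄₇ r₃₆₉`. -/
def ell3 : Fun →+* Fun := word [r147, r258, r147, r369]

/-! ### The parameters `q`, `a`, `b` and the normalization factor -/

/-- `q^{1/3}`, where `q = a₀ a₁ a₂² a₃³ a₄² a₅ a₆²`. -/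
def qRoot (α : Param) : ℂ :=
  α 0 * α 1 * (α 2) ^ 2 * (α 3) ^ 3 * (α 4) ^ 2 * α 5 * (α 6) ^ 2

/-- `q = a₀ a₁ a₂² a₃³ a₄² a₅ a₆²`. -/
def q (α : Param) : ℂ := qRoot α ^ 3

/-- `a = (a₀ a₁ a₅)^{1/3}`. -/
def a (α : Param) : ℂ := α 0 * α 1 * α 5

/-- `b = (a₂ a₄ a₆ q)^{1/3}`. -/
def b (α : Param) : ℂ := α 2 * α 4 * α 6 * qRoot α

/-- The `q`-shifted factorial `(x; p, p)_∞ = ∏_{i,j ≥ 0} (1 - x p^i p^j)`. -/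
def poch (x p : ℂ) : ℂ := ∏' ij : ℕ × ℕ, (1 - x * p ^ ij.1 * p ^ ij.2)

/-- The numerator of the normalization factor. -/
def normNum (q a b : ℂ) : ℂ :=
  poch (-(a * q / b)) q * poch (-(a * b ^ 2 * q)) q * poch (-(q / (a ^ 2 * b))) q *
  (poch (b ^ 3 * q ^ 3 / a ^ 3) (q ^ 3) * poch (q ^ 3 / (a ^ 3 * b ^ 6)) (q ^ 3) *
    poch (a ^ 6 * b ^ 3 * q ^ 3) (q ^ 3))

/-- The denominator of the normalization factor. -/
def normDen (q a b : ℂ) : ℂ :=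
  poch (b ^ 2 * q ^ 2 / a ^ 2) (q ^ 2) * poch (q ^ 2 / (a ^ 2 * b ^ 4)) (q ^ 2) *
    poch (a ^ 4 * b ^ 2 * q ^ 2) (q ^ 2)

/-- The normalization factor `N(a, b)`. -/
def norm (q a b : ℂ) : ℂ := normNum q a b / normDen q a b

/-- `N` has neither a zero nor a pole at `(a, b)`. -/
def NormRegular (q a b : ℂ) : Prop := normNum q a b ≠ 0 ∧ normDen q a b ≠ 0

/-- The normalization factor `N(a, b)` of the `U_i` has neither a zero nor a pole; `r = q^{1/3}`. -/
def RegularU (r a b : ℂ) : Prop := NormRegular (r ^ 3) a b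

/-- The normalization factor `N(q^{1/3} a, q^{-2/3} b)` of the `V_i` has neither a zero nor a pole;
`r = q^{1/3}`. -/
def RegularV (r a b : ℂ) : Prop := NormRegular (r ^ 3) (r * a) ((r ^ 2)⁻¹ * b)

/-- The normalization factor `N(q^{-1/3} a, q^{-1/3} b)` of the `W_i` has neither a zero nor a pole;
`r = q^{1/3}`. -/
def RegularW (r a b : ℂ) : Prop := NormRegular (r ^ 3) (r⁻¹ * a) (r⁻¹ * b)

/-! ### Normalized tau-functions and the constants

An index `i ∈ ℤ/3ℤ` takes the values `1, 2, 3 = 0`; the lists below start with the value at `0`. -/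

/-- `U₁, U₂, U₃ = τ₁, τ₄, τ₇` divided by `N(a, b)`. -/
def U (i : ZMod 3) : Fun :=
  tau ((![7, 1, 4] : Fin 3 → Fin 9) i) / ofCoeff fun α => norm (q α) (a α) (b α)

/-- `V₁, V₂, V₃ = τ₂, τ₅, τ₈` divided by `N(q^{1/3} a, q^{-2/3} b)`. -/
def V (i : ZMod 3) : Fun :=
  tau ((![8, 2, 5] : Fin 3 → Fin 9) i) /
    ofCoeff fun α => norm (q α) (qRoot α * a α) ((qRoot α ^ 2)⁻¹ * b α)

/-- `W₁, W₂, W₃ = τ₃, τ₆, τ₉` divided by `N(q^{-1/3} a, q^{-1/3} b)`. -/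
def W (i : ZMod 3) : Fun :=
  tau ((![9, 3, 6] : Fin 3 → Fin 9) i) /
    ofCoeff fun α => norm (q α) ((qRoot α)⁻¹ * a α) ((qRoot α)⁻¹ * b α)

/-- `γ₁ = (a₀a₆²/(a₁a₂²))^{1/3}`, `γ₂ = (a₁a₂²/(a₄²a₅))^{1/3}`, `γ₃ = (a₄²a₅/(a₀a₆²))^{1/3}`. -/
def gamma (i : ZMod 3) (α : Param) : ℂ :=
  (![α 4 ^ 2 * α 5 / (α 0 * α 6 ^ 2), α 0 * α 6 ^ 2 / (α 1 * α 2 ^ 2),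
    α 1 * α 2 ^ 2 / (α 4 ^ 2 * α 5)] : Fin 3 → ℂ) i

/-- `δ₁ = (a₀a₂/(a₁a₆))^{1/3}`, `δ₂ = (a₁a₄/(a₂a₅))^{1/3}`, `δ₃ = (a₅a₆/(a₀a₄))^{1/3}`. -/
def delta (i : ZMod 3) (α : Param) : ℂ :=
  (![α 5 * α 6 / (α 0 * α 4), α 0 * α 2 / (α 1 * α 6), α 1 * α 4 / (α 2 * α 5)] : Fin 3 → ℂ) i

/-- `ε₁ = (a₁²a₂/(a₀²a₆))^{1/3}`, `ε₂ = (a₄a₅²/(a₁²a₂))^{1/3}`, `ε₃ = (a₀²a₆/(a₄a₅²))^{1/3}`. -/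
def epsilon (i : ZMod 3) (α : Param) : ℂ :=
  (![α 0 ^ 2 * α 6 / (α 4 * α 5 ^ 2), α 1 ^ 2 * α 2 / (α 0 ^ 2 * α 6),
    α 4 * α 5 ^ 2 / (α 1 ^ 2 * α 2)] : Fin 3 → ℂ) i

end QPE6

end

namespace QPE6

/-! ### Double infinite products -/

theorem summable_norm_mul_pow_mul_pow {p : ℂ} (hp : ‖p‖ < 1) (x : ℂ) :
    Summable fun ij : ℕ × ℕ => ‖-(x * p ^ ij.1 * p ^ ij.2)‖ := by
  have hg := summable_geometric_of_lt_one (norm_nonneg p) hp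
  have h := (hg.mul_of_nonneg hg (fun n => pow_nonneg (norm_nonneg p) n)
    (fun n => pow_nonneg (norm_nonneg p) n)).mul_left ‖x‖
  refine h.congr fun ij => ?_
  simp only [norm_neg, norm_mul, norm_pow, mul_assoc]

theorem multipliable_one_sub_mul_pow_mul_pow {p : ℂ} (hp : ‖p‖ < 1) (x : ℂ) :
    Multipliable fun ij : ℕ × ℕ => (1 - x * p ^ ij.1 * p ^ ij.2) := by
  simpa only [sub_eq_add_neg] using
    multipliable_one_add_of_summable (summable_norm_mul_pow_mul_pow hp x)

theorem multipliable_one_sub_mul_pow {p : ℂ} (hp : ‖p‖ < 1) (x : ℂ) :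
    Multipliable fun j : ℕ => (1 - x * p ^ j) := by
  have h : Summable fun j : ℕ => ‖-(x * p ^ j)‖ := by
    refine ((summable_geometric_of_lt_one (norm_nonneg p) hp).mul_left ‖x‖).congr fun j => ?_
    simp only [norm_neg, norm_mul, norm_pow]
  simpa only [sub_eq_add_neg] using multipliable_one_add_of_summable h

theorem tprod_one_sub_mul_pow_succ {p : ℂ} (hp : ‖p‖ < 1) (x : ℂ) :
    ∏' j : ℕ, (1 - x * p ^ j) = (1 - x) * ∏' j : ℕ, (1 - x * p * p ^ j) := by
  have e : (fun j : ℕ => 1 - x * p * p ^ j) = fun j : ℕ => 1 - x * p ^ (j + 1) :=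
    funext fun j => by rw [pow_succ', mul_assoc]
  have h : Multipliable fun j : ℕ => 1 - x * p ^ (j + 1) :=
    e ▸ multipliable_one_sub_mul_pow hp (x * p)
  have key := tprod_eq_zero_mul' (f := fun j : ℕ => 1 - x * p ^ j) h
  rw [e]
  simpa only [pow_zero, mul_one] using key

theorem poch_eq_mul_poch {p : ℂ} (hp : ‖p‖ < 1) (x : ℂ) :
    poch x p = (∏' j : ℕ, (1 - x * p ^ j)) * poch (x * p) p := by
  have hfib (x : ℂ) : HasProd (fun i : ℕ => ∏' j : ℕ, (1 - x * p ^ i * p ^ j)) (poch x p) :=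
    (multipliable_one_sub_mul_pow_mul_pow hp x).hasProd.prod_fiberwise fun i =>
      (multipliable_one_sub_mul_pow hp (x * p ^ i)).hasProd
  have h := hfib (x * p)
  have e : (fun i : ℕ => ∏' j : ℕ, (1 - x * p * p ^ i * p ^ j)) =
      fun i : ℕ => ∏' j : ℕ, (1 - x * p ^ (i + 1) * p ^ j) := by
    funext i; congr 1; funext j; ring
  rw [e] at h
  rw [← (hfib x).tprod_eq, tprod_eq_zero_mul' h.multipliable, h.tprod_eq, pow_zero, mul_one]

theorem poch_mul_poch {p : ℂ} (hp : ‖p‖ < 1) (x : ℂ) :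
    poch x p * poch (x * p * p) p = (1 - x) * poch (x * p) p ^ 2 := by
  rw [poch_eq_mul_poch hp x, tprod_one_sub_mul_pow_succ hp x, poch_eq_mul_poch hp (x * p)]
  ring

/-! ### The normalization factor -/

/-- The numerator of the factor of `N` that depends on one of `a / b`, `a b²`, `1 / (a² b)`. -/
noncomputable def factorNum (q u : ℂ) : ℂ := poch (-(u * q)) q * poch (q ^ 3 / u ^ 3) (q ^ 3)

/-- The denominator of the factor of `N` that depends on one of `a / b`, `a b²`, `1 / (a² b)`. -/
noncomputable def factorDen (q u : ℂ) : ℂ := poch (q ^ 2 / u ^ 2) (q ^ 2)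

theorem normNum_eq {q a b u₁ u₂ u₃ : ℂ} (ha : a ≠ 0) (hb : b ≠ 0) (h₁ : u₁ = a / b)
    (h₂ : u₂ = a * b ^ 2) (h₃ : u₃ = 1 / (a ^ 2 * b)) :
    normNum q a b = factorNum q u₁ * factorNum q u₂ * factorNum q u₃ := by
  subst h₁ h₂ h₃
  have e1 : q ^ 3 / (a / b) ^ 3 = b ^ 3 * q ^ 3 / a ^ 3 := by field_simp
  have e2 : q ^ 3 / (a * b ^ 2) ^ 3 = q ^ 3 / (a ^ 3 * b ^ 6) := by congr 1; ring
  have e3 : q ^ 3 / (1 / (a ^ 2 * b)) ^ 3 = a ^ 6 * b ^ 3 * q ^ 3 := by field_simp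
  have e4 : a / b * q = a * q / b := by ring
  have e5 : 1 / (a ^ 2 * b) * q = q / (a ^ 2 * b) := by ring
  rw [normNum, factorNum, factorNum, factorNum, e1, e2, e3, e4, e5]
  ring

theorem normDen_eq {q a b u₁ u₂ u₃ : ℂ} (ha : a ≠ 0) (hb : b ≠ 0) (h₁ : u₁ = a / b)
    (h₂ : u₂ = a * b ^ 2) (h₃ : u₃ = 1 / (a ^ 2 * b)) :
    normDen q a b = factorDen q u₁ * factorDen q u₂ * factorDen q u₃ := by
  subst h₁ h₂ h₃
  have e1 : q ^ 2 / (a / b) ^ 2 = b ^ 2 * q ^ 2 / a ^ 2 := by field_simp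
  have e2 : q ^ 2 / (a * b ^ 2) ^ 2 = q ^ 2 / (a ^ 2 * b ^ 4) := by congr 1; ring
  have e3 : q ^ 2 / (1 / (a ^ 2 * b)) ^ 2 = a ^ 4 * b ^ 2 * q ^ 2 := by field_simp
  rw [normDen, factorDen, factorDen, factorDen, e1, e2, e3]

theorem factorNum_mul_factorNum {q : ℂ} (hq0 : q ≠ 0) (hq : ‖q‖ < 1) {u : ℂ} (hu : u ≠ 0) :
    factorNum q (q * u) * factorNum q (u / q) = (1 + u) * (1 - 1 / u ^ 3) * factorNum q u ^ 2 := by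
  have hq3 : ‖q ^ 3‖ < 1 := by rw [norm_pow]; exact pow_lt_one₀ (norm_nonneg q) hq (by norm_num)
  have h1 := poch_mul_poch hq (-u)
  have h3 := poch_mul_poch hq3 (1 / u ^ 3)
  have e1 : -(u / q * q) = -u := by field_simp
  have e2 : -(q * u * q) = -u * q * q := by ring
  have e3 : -(u * q) = -u * q := by ring
  have e4 : q ^ 3 / (q * u) ^ 3 = 1 / u ^ 3 := by field_simp
  have e5 : q ^ 3 / (u / q) ^ 3 = 1 / u ^ 3 * q ^ 3 * q ^ 3 := by field_simp
  have e6 : q ^ 3 / u ^ 3 = 1 / u ^ 3 * q ^ 3 := by ring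
  rw [factorNum, factorNum, factorNum, e1, e2, e3, e4, e5, e6]
  linear_combination (poch (1 / u ^ 3) (q ^ 3) * poch (1 / u ^ 3 * q ^ 3 * q ^ 3) (q ^ 3)) * h1 +
    ((1 + u) * poch (-u * q) q ^ 2) * h3

theorem factorDen_mul_factorDen {q : ℂ} (hq0 : q ≠ 0) (hq : ‖q‖ < 1) {u : ℂ} (hu : u ≠ 0) :
    factorDen q (q * u) * factorDen q (u / q) = (1 - 1 / u ^ 2) * factorDen q u ^ 2 := by
  have hq2 : ‖q ^ 2‖ < 1 := by rw [norm_pow]; exact pow_lt_one₀ (norm_nonneg q) hq (by norm_num)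
  have h := poch_mul_poch hq2 (1 / u ^ 2)
  have e4 : q ^ 2 / (q * u) ^ 2 = 1 / u ^ 2 := by field_simp
  have e5 : q ^ 2 / (u / q) ^ 2 = 1 / u ^ 2 * q ^ 2 * q ^ 2 := by field_simp
  have e6 : q ^ 2 / u ^ 2 = 1 / u ^ 2 * q ^ 2 := by ring
  rw [factorDen, factorDen, factorDen, e4, e5, e6, h]

/-- The ratio of the four values of `N` in a bilinear equation. In the order of the indices the
triples `(a / b, a b², 1 / (a² b))` are up to a permutation `(q u, v, w)`, `(u / q, q v, q w)`,
`(u, v, q w)`, `(u, q v, w)`; `A = 1 / u` is the value of the root of the reflection involved. -/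
theorem factor_ratio {q : ℂ} (hq0 : q ≠ 0) (hq : ‖q‖ < 1) {u v w v' w' A : ℂ} (hA : A ≠ 0)
    (hu : u = A⁻¹) {n₀ n₁ n₂ n₃ d₀ d₁ d₂ d₃ : ℂ}
    (hn₀ : n₀ = factorNum q (q * u) * factorNum q v * factorNum q w)
    (hn₁ : n₁ = factorNum q (u / q) * factorNum q v' * factorNum q w')
    (hn₂ : n₂ = factorNum q u * factorNum q v * factorNum q w')
    (hn₃ : n₃ = factorNum q u * factorNum q v' * factorNum q w)
    (hd₀ : d₀ = factorDen q (q * u) * factorDen q v * factorDen q w)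
    (hd₁ : d₁ = factorDen q (u / q) * factorDen q v' * factorDen q w')
    (hd₂ : d₂ = factorDen q u * factorDen q v * factorDen q w')
    (hd₃ : d₃ = factorDen q u * factorDen q v' * factorDen q w)
    (h₀ : d₀ ≠ 0) (h₁ : d₁ ≠ 0) (h₂ : d₂ ≠ 0) (h₃ : d₃ ≠ 0) :
    A * (n₀ / d₀ * (n₁ / d₁)) = (1 + A + A ^ 2) * (n₂ / d₂ * (n₃ / d₃)) := by
  have hu0 : u ≠ 0 := hu ▸ inv_ne_zero hA
  have hn : n₀ * n₁ = (1 + A⁻¹) * (1 - A ^ 3) * (n₂ * n₃) := by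
    have h := factorNum_mul_factorNum hq0 hq hu0
    rw [show 1 / u ^ 3 = A ^ 3 by rw [hu]; field_simp] at h
    rw [hn₀, hn₁, hn₂, hn₃, ← hu]
    linear_combination (factorNum q v * factorNum q w * factorNum q v' * factorNum q w') * h
  have hd : d₀ * d₁ = (1 - A ^ 2) * (d₂ * d₃) := by
    have h := factorDen_mul_factorDen hq0 hq hu0
    rw [show 1 / u ^ 2 = A ^ 2 by rw [hu]; field_simp] at h
    rw [hd₀, hd₁, hd₂, hd₃]
    linear_combination (factorDen q v * factorDen q w * factorDen q v' * factorDen q w') * h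
  have hA2 : 1 - A ^ 2 ≠ 0 := by
    intro h
    rw [h, zero_mul] at hd
    exact mul_ne_zero h₀ h₁ hd
  rw [div_mul_div_comm, div_mul_div_comm, hn, hd]
  field_simp
  ring

/-! ### The action on quotients, coefficients and indeterminates -/

theorem s_apply (i : Fin 7) (F : Fun) (α : Param) :
    s i F α = reflSubst i α (F (reflParam i α)) := rfl

theorem s_div (i : Fin 7) (F G : Fun) : s i (F / G) = s i F / s i G := by
  funext α
  simp only [s_apply, Pi.div_apply, map_div₀]

theorem s_ofCoeff (i : Fin 7) (c : Param → ℂ) :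
    s i (ofCoeff c) = ofCoeff fun α => c (reflParam i α) := by
  funext α
  simp only [s_apply, ofCoeff, AlgHom.commutes]

theorem s_tau_apply (i : Fin 7) (k : Fin 9) (α : Param) : s i (tau k) α = reflTau i α k := by
  rw [s_apply, tau, tauVar, reflSubst, IsFractionRing.liftAlgHom_apply,
    IsFractionRing.lift_algebraMap]
  exact MvPolynomial.aeval_X _ _

theorem s_tau {i : Fin 7} (hi : i ≠ 3) (k : Fin 9) : s i (tau k) = tau (tauPerm i k) := by
  funext α
  rw [s_tau_apply, reflTau, if_neg hi, tau]

theorem word_nil (F : Fun) : word [] F = F := rfl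

theorem word_cons (w : Fun →+* Fun) (ws : List (Fun →+* Fun)) (F : Fun) :
    word (w :: ws) F = word ws (w F) := rfl

theorem word_div (ws : List (Fun →+* Fun)) (h : ∀ w ∈ ws, ∀ F G, w (F / G) = w F / w G)
    (F G : Fun) : word ws (F / G) = word ws F / word ws G := by
  induction ws generalizing F G with
  | nil => rfl
  | cons w ws ih =>
    rw [word_cons, word_cons, word_cons, h w (by simp), ih fun w hw => h w (by simp [hw])]

theorem r147_div (F G : Fun) : r147 (F / G) = r147 F / r147 G := s_div 3 F G

theorem r258_div (F G : Fun) : r258 (F / G) = r258 F / r258 G :=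
  word_div _ (by simp [s_div, r147_div]) F G

theorem r369_div (F G : Fun) : r369 (F / G) = r369 F / r369 G :=
  word_div _ (by simp [s_div, r258_div]) F G

theorem ell1_div (F G : Fun) : ell1 (F / G) = ell1 F / ell1 G :=
  word_div _ (by simp [r147_div, r258_div, r369_div]) F G

theorem ell2_div (F G : Fun) : ell2 (F / G) = ell2 F / ell2 G :=
  word_div _ (by simp [r147_div, r258_div, r369_div]) F G

theorem ell3_div (F G : Fun) : ell3 (F / G) = ell3 F / ell3 G :=
  word_div _ (by simp [r147_div, r258_div, r369_div]) F G

/-! ### The action on the parameters -/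

theorem mul_inv_sq {G : Type*} [Group G] (x : G) : x * (x ^ 2)⁻¹ = x⁻¹ := by group

/-- The action of `r147` on the parameters. -/
def param147 (α : Param) : Param := ![α 0, α 1, α 2 * α 3, (α 3)⁻¹, α 4 * α 3, α 5, α 6 * α 3]

/-- The action of `s₂ s₄ s₆` on the parameters. -/
def param246 (α : Param) : Param :=
  ![α 0 * α 6, α 1 * α 2, (α 2)⁻¹, α 3 * α 6 * α 4 * α 2, (α 4)⁻¹, α 5 * α 4, (α 6)⁻¹]

/-- The action of `s₀ s₁ s₅` on the parameters. -/
def param015 (α : Param) : Param :=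
  ![(α 0)⁻¹, (α 1)⁻¹, α 2 * α 1, α 3, α 4 * α 5, (α 5)⁻¹, α 6 * α 0]

/-- The action of `r258` on the parameters. -/
def param258 (α : Param) : Param := param246 (param147 (param246 α))

/-- The action of `r369` on the parameters. -/
def param369 (α : Param) : Param := param015 (param258 (param015 α))

theorem reflParam_three (α : Param) : reflParam 3 α = param147 α := by
  funext j
  fin_cases j <;> simp [reflParam, cartan, param147, mul_inv_sq]

theorem reflParam_two_four_six (α : Param) :
    reflParam 2 (reflParam 4 (reflParam 6 α)) = param246 α := by
  funext j
  fin_cases j <;> simp [reflParam, cartan, param246, mul_inv_sq]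

theorem reflParam_zero_one_five (α : Param) :
    reflParam 0 (reflParam 1 (reflParam 5 α)) = param015 α := by
  funext j
  fin_cases j <;> simp [reflParam, cartan, param015, mul_inv_sq]

theorem r147_ofCoeff (c : Param → ℂ) : r147 (ofCoeff c) = ofCoeff fun α => c (param147 α) := by
  simp only [r147, s_ofCoeff, reflParam_three]

theorem word246_ofCoeff (c : Param → ℂ) :
    s 6 (s 4 (s 2 (ofCoeff c))) = ofCoeff fun α => c (param246 α) := by
  simp only [s_ofCoeff, reflParam_two_four_six]

theorem word015_ofCoeff (c : Param → ℂ) :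
    s 5 (s 1 (s 0 (ofCoeff c))) = ofCoeff fun α => c (param015 α) := by
  simp only [s_ofCoeff, reflParam_zero_one_five]

theorem r258_apply (F : Fun) :
    r258 F = s 6 (s 4 (s 2 (r147 (s 6 (s 4 (s 2 F)))))) := rfl

theorem r369_apply (F : Fun) :
    r369 F = s 5 (s 1 (s 0 (r258 (s 5 (s 1 (s 0 F)))))) := by
  simp only [r369, word_cons, word_nil]

theorem r258_ofCoeff (c : Param → ℂ) : r258 (ofCoeff c) = ofCoeff fun α => c (param258 α) := by
  simp only [r258_apply, word246_ofCoeff, r147_ofCoeff, param258]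

theorem r369_ofCoeff (c : Param → ℂ) : r369 (ofCoeff c) = ofCoeff fun α => c (param369 α) := by
  simp only [r369_apply, word015_ofCoeff, r258_ofCoeff, param369]

theorem ell1_ofCoeff (c : Param → ℂ) : ell1 (ofCoeff c) =
    ofCoeff fun α => c (param258 (param369 (param258 (param147 α)))) := by
  simp only [ell1, word_cons, word_nil, r147_ofCoeff, r258_ofCoeff, r369_ofCoeff]

theorem ell2_ofCoeff (c : Param → ℂ) : ell2 (ofCoeff c) =
    ofCoeff fun α => c (param369 (param147 (param369 (param258 α)))) := by
  simp only [ell2, word_cons, word_nil, r147_ofCoeff, r258_ofCoeff, r369_ofCoeff]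

theorem ell3_ofCoeff (c : Param → ℂ) : ell3 (ofCoeff c) =
    ofCoeff fun α => c (param147 (param258 (param147 (param369 α)))) := by
  simp only [ell3, word_cons, word_nil, r147_ofCoeff, r258_ofCoeff, r369_ofCoeff]

theorem qRoot_ne_zero (α : Param) : qRoot α ≠ 0 := by simp [qRoot]

theorem a_ne_zero (α : Param) : a α ≠ 0 := by simp [a]

theorem b_ne_zero (α : Param) : b α ≠ 0 := by simp [b, qRoot_ne_zero]

theorem qRoot_param147 (α : Param) : qRoot (param147 α) = qRoot α := by
  simp [qRoot, param147]; field_simp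

theorem qRoot_param246 (α : Param) : qRoot (param246 α) = qRoot α := by
  simp [qRoot, param246]; field_simp

theorem qRoot_param015 (α : Param) : qRoot (param015 α) = qRoot α := by
  simp [qRoot, param015]; field_simp

theorem qRoot_param258 (α : Param) : qRoot (param258 α) = qRoot α := by
  simp only [param258, qRoot_param246, qRoot_param147]

theorem qRoot_param369 (α : Param) : qRoot (param369 α) = qRoot α := by
  simp only [param369, qRoot_param015, qRoot_param258]

theorem a_param147 (α : Param) : a (param147 α) = a α := by
  simp [a, param147]

theorem b_param147 (α : Param) : b (param147 α) = qRoot α ^ 3 / (a α * b α) := by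
  rw [b, qRoot_param147, eq_div_iff (mul_ne_zero (a_ne_zero α) (b_ne_zero α))]
  simp [a, b, qRoot, param147]; ring

theorem param258_eq (α : Param) : param258 α =
    let m := α 2 * α 3 * α 4 * α 6
    ![α 0 * m, α 1 * m, α 2 * m⁻¹, α 3 * m, α 4 * m⁻¹, α 5 * m, α 6 * m⁻¹] := by
  funext j
  fin_cases j <;> ext <;> simp [param258, param246, param147] <;> field_simp

theorem param369_eq (α : Param) : param369 α =
    let m := α 0 * α 1 * α 2 * α 3 * α 4 * α 5 * α 6
    ![α 0 * m⁻¹, α 1 * m⁻¹, α 2, α 3 * m, α 4, α 5 * m⁻¹, α 6] := by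
  funext j
  fin_cases j <;> ext <;> simp [param369, param258_eq, param015] <;> field_simp

theorem a_param258 (α : Param) : a (param258 α) = b α := by
  simp [a, b, qRoot, param258_eq]; ring

theorem b_param258 (α : Param) : b (param258 α) = a α := by
  rw [b, qRoot_param258]
  simp [a, qRoot, param258_eq]; field_simp

theorem a_param369 (α : Param) : a (param369 α) = (a α * b α)⁻¹ := by
  apply eq_inv_of_mul_eq_one_left
  simp [a, b, qRoot, param369_eq]; field_simp

theorem b_param369 (α : Param) : b (param369 α) = b α := by
  rw [b, b, qRoot_param369]
  simp [param369_eq]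

/-! ### The action of the three reflections on the indeterminates -/

/-- The indices of the indeterminates in `U₃, U₁, U₂`. -/
def uIdx : ZMod 3 → Fin 9 := (![7, 1, 4] : Fin 3 → Fin 9)

/-- The indices of the indeterminates in `V₃, V₁, V₂`. -/
def vIdx : ZMod 3 → Fin 9 := (![8, 2, 5] : Fin 3 → Fin 9)

/-- The indices of the indeterminates in `W₃, W₁, W₂`. -/
def wIdx : ZMod 3 → Fin 9 := (![9, 3, 6] : Fin 3 → Fin 9)

/-- The shape of the value of a reflection at one of the three indeterminates with indices `u i`
it moves: `A` is the value of its root, `g` is the family of coefficients. -/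
noncomputable def reflFormula (A : Param → ℂ) (g : ZMod 3 → Param → ℂ) (u v w : ZMod 3 → Fin 9)
    (i : ZMod 3) : Fun :=
  (ofCoeff (g (i + 1)) * (tau (u i) * tau (v i) * tau (w i)) +
    ofCoeff (fun α => (A α)⁻¹) * ofCoeff (g (i + 2)) *
      (tau (u (i + 1)) * tau (v (i + 1)) * tau (w (i + 1))) +
    ofCoeff A * ofCoeff (g i) * (tau (u (i + 2)) * tau (v (i + 2)) * tau (w (i + 2)))) /
  (tau (u (i + 1)) * tau (u (i + 2)))

theorem gamma_zero (α : Param) : gamma 0 α = cy α := by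
  simp [gamma, cy]; field_simp

theorem gamma_one (α : Param) : gamma 1 α = cz α := by
  simp [gamma, cz]; field_simp

theorem gamma_two (α : Param) : gamma 2 α = cx α := by
  simp [gamma, cx]; field_simp

theorem r147_tau_uIdx (i : ZMod 3) :
    r147 (tau (uIdx i)) = reflFormula (fun α => (α 3 : ℂ) ^ 3) gamma uIdx vIdx wIdx i := by
  funext α
  rw [r147, s_tau_apply]
  fin_cases i
  · change linForm α ((α 3 ^ 3)⁻¹) (α 3 ^ 3) 1 / (tauVar 1 * tauVar 4) =
      (algebraMap ℂ TauField (gamma 1 α) * (tauVar 7 * tauVar 8 * tauVar 9) +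
        algebraMap ℂ TauField ((α 3 : ℂ) ^ 3)⁻¹ * algebraMap ℂ TauField (gamma 2 α) *
          (tauVar 1 * tauVar 2 * tauVar 3) +
        algebraMap ℂ TauField ((α 3 : ℂ) ^ 3) * algebraMap ℂ TauField (gamma 0 α) *
          (tauVar 4 * tauVar 5 * tauVar 6)) / (tauVar 1 * tauVar 4)
    simp only [linForm, gamma_zero, gamma_one, gamma_two, ← map_mul, Units.val_mul,
      Units.val_pow_eq_pow_val, Units.val_inv_eq_inv_val, one_mul]
    ring
  · change linForm α 1 ((α 3 ^ 3)⁻¹) (α 3 ^ 3) / (tauVar 4 * tauVar 7) =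
      (algebraMap ℂ TauField (gamma 2 α) * (tauVar 1 * tauVar 2 * tauVar 3) +
        algebraMap ℂ TauField ((α 3 : ℂ) ^ 3)⁻¹ * algebraMap ℂ TauField (gamma 0 α) *
          (tauVar 4 * tauVar 5 * tauVar 6) +
        algebraMap ℂ TauField ((α 3 : ℂ) ^ 3) * algebraMap ℂ TauField (gamma 1 α) *
          (tauVar 7 * tauVar 8 * tauVar 9)) / (tauVar 4 * tauVar 7)
    simp only [linForm, gamma_zero, gamma_one, gamma_two, ← map_mul, Units.val_mul,
      Units.val_pow_eq_pow_val, Units.val_inv_eq_inv_val, one_mul]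
  · change linForm α (α 3 ^ 3) 1 ((α 3 ^ 3)⁻¹) / (tauVar 1 * tauVar 7) =
      (algebraMap ℂ TauField (gamma 0 α) * (tauVar 4 * tauVar 5 * tauVar 6) +
        algebraMap ℂ TauField ((α 3 : ℂ) ^ 3)⁻¹ * algebraMap ℂ TauField (gamma 1 α) *
          (tauVar 7 * tauVar 8 * tauVar 9) +
        algebraMap ℂ TauField ((α 3 : ℂ) ^ 3) * algebraMap ℂ TauField (gamma 2 α) *
          (tauVar 1 * tauVar 2 * tauVar 3)) / (tauVar 7 * tauVar 1)
    simp only [linForm, gamma_zero, gamma_one, gamma_two, ← map_mul, Units.val_mul,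
      Units.val_pow_eq_pow_val, Units.val_inv_eq_inv_val, one_mul]
    ring

theorem r147_tau {k : Fin 9} (h1 : k ≠ 1) (h4 : k ≠ 4) (h7 : k ≠ 7) : r147 (tau k) = tau k := by
  funext α
  rw [r147, s_tau_apply, reflTau, if_pos rfl, if_neg h1, if_neg h4, if_neg h7, tau]

theorem word246_tau (k : Fin 9) : s 6 (s 4 (s 2 (tau k))) =
    tau ((Equiv.swap 1 2 * Equiv.swap 7 8 * Equiv.swap 4 5 : Equiv.Perm (Fin 9)) k) := by
  rw [s_tau (by decide), s_tau (by decide), s_tau (by decide)]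
  rfl

theorem word015_tau (k : Fin 9) : s 5 (s 1 (s 0 (tau k))) =
    tau ((Equiv.swap 8 9 * Equiv.swap 5 6 * Equiv.swap 2 3 : Equiv.Perm (Fin 9)) k) := by
  rw [s_tau (by decide), s_tau (by decide), s_tau (by decide)]
  rfl

theorem r147_tau_vIdx (i : ZMod 3) : r147 (tau (vIdx i)) = tau (vIdx i) := by
  apply r147_tau <;> revert i <;> decide

theorem r147_tau_wIdx (i : ZMod 3) : r147 (tau (wIdx i)) = tau (wIdx i) := by
  apply r147_tau <;> revert i <;> decide

theorem word246_tau_uIdx (i : ZMod 3) : s 6 (s 4 (s 2 (tau (uIdx i)))) = tau (vIdx i) := by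
  rw [word246_tau]; congr 1; revert i; decide

theorem word246_tau_vIdx (i : ZMod 3) : s 6 (s 4 (s 2 (tau (vIdx i)))) = tau (uIdx i) := by
  rw [word246_tau]; congr 1; revert i; decide

theorem word246_tau_wIdx (i : ZMod 3) : s 6 (s 4 (s 2 (tau (wIdx i)))) = tau (wIdx i) := by
  rw [word246_tau]; congr 1; revert i; decide

theorem word015_tau_uIdx (i : ZMod 3) : s 5 (s 1 (s 0 (tau (uIdx i)))) = tau (uIdx i) := by
  rw [word015_tau]; congr 1; revert i; decide

theorem word015_tau_vIdx (i : ZMod 3) : s 5 (s 1 (s 0 (tau (vIdx i)))) = tau (wIdx i) := by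
  rw [word015_tau]; congr 1; revert i; decide

theorem word015_tau_wIdx (i : ZMod 3) : s 5 (s 1 (s 0 (tau (wIdx i)))) = tau (vIdx i) := by
  rw [word015_tau]; congr 1; revert i; decide

theorem r258_tau_uIdx (i : ZMod 3) : r258 (tau (uIdx i)) = tau (uIdx i) := by
  rw [r258_apply, word246_tau_uIdx, r147_tau_vIdx, word246_tau_vIdx]

theorem r258_tau_wIdx (i : ZMod 3) : r258 (tau (wIdx i)) = tau (wIdx i) := by
  rw [r258_apply, word246_tau_wIdx, r147_tau_wIdx, word246_tau_wIdx]

theorem r258_tau_vIdx (i : ZMod 3) : r258 (tau (vIdx i)) =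
    reflFormula (fun α => (param246 α 3 : ℂ) ^ 3) (fun j α => gamma j (param246 α))
      vIdx uIdx wIdx i := by
  rw [r258_apply, word246_tau_vIdx, r147_tau_uIdx]
  simp only [reflFormula, s_div, map_add, map_mul, word246_ofCoeff, word246_tau_uIdx,
    word246_tau_vIdx, word246_tau_wIdx]

theorem r369_tau_uIdx (i : ZMod 3) : r369 (tau (uIdx i)) = tau (uIdx i) := by
  rw [r369_apply, word015_tau_uIdx, r258_tau_uIdx, word015_tau_uIdx]

theorem r369_tau_vIdx (i : ZMod 3) : r369 (tau (vIdx i)) = tau (vIdx i) := by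
  rw [r369_apply, word015_tau_vIdx, r258_tau_wIdx, word015_tau_wIdx]

theorem r369_tau_wIdx (i : ZMod 3) : r369 (tau (wIdx i)) =
    reflFormula (fun α => (param246 (param015 α) 3 : ℂ) ^ 3)
      (fun j α => gamma j (param246 (param015 α))) wIdx uIdx vIdx i := by
  rw [r369_apply, word015_tau_wIdx, r258_tau_vIdx]
  simp only [reflFormula, s_div, map_add, map_mul, word015_ofCoeff, word015_tau_uIdx,
    word015_tau_vIdx, word015_tau_wIdx]

theorem gamma_param246 (i : ZMod 3) (α : Param) : gamma i (param246 α) = delta i α := by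
  have h (j : Fin 3) : gamma (j : ZMod 3) (param246 α) = delta j α := by
    fin_cases j <;> simp [gamma, delta, param246] <;> field_simp
  exact h i

theorem delta_param015 (i : ZMod 3) (α : Param) : delta i (param015 α) = epsilon i α := by
  have h (j : Fin 3) : delta (j : ZMod 3) (param015 α) = epsilon j α := by
    fin_cases j <;> simp [epsilon, delta, param015] <;> field_simp
  exact h i

theorem a147_eq (α : Param) : (α 3 : ℂ) ^ 3 = q α / (a α * b α ^ 2) := by
  rw [eq_div_iff (by simp [a_ne_zero, b_ne_zero])]
  simp [q, a, b, qRoot]; ring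

theorem a258_eq (α : Param) : (param246 α 3 : ℂ) ^ 3 = b α / a α := by
  rw [eq_div_iff (a_ne_zero α)]
  simp [a, b, qRoot, param246]; ring

theorem a369_eq (α : Param) : (param246 (param015 α) 3 : ℂ) ^ 3 = a α ^ 2 * b α := by
  simp [a, b, qRoot, param246, param015]; ring

theorem bilinear_identity {K : Type*} [Field K] {A c c' g₀ g₁ g₂ X₀ X₁ X₂ t₀ t₁ t₂ v w E₀ E₁
    N₀ N₁ N₂ N₃ : K} (hA : A ≠ 0) (ht₀ : t₀ ≠ 0) (ht₁ : t₁ ≠ 0) (ht₂ : t₂ ≠ 0)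
    (hN₀ : N₀ ≠ 0) (hN₁ : N₁ ≠ 0) (hN₂ : N₂ ≠ 0) (hN₃ : N₃ ≠ 0) (hc : c' = c * A)
    (hX₂ : X₂ = t₂ * v * w)
    (hE₀ : E₀ = (g₁ * X₀ + A⁻¹ * g₂ * X₁ + A * g₀ * X₂) / (t₁ * t₂))
    (hE₁ : E₁ = (g₂ * X₁ + A⁻¹ * g₀ * X₂ + A * g₁ * X₀) / (t₂ * t₀))
    (hN : A * (N₀ * N₁) = (1 + A + A ^ 2) * (N₂ * N₃)) :
    c * (t₀ / N₀) * (E₁ / N₁) - c' * (E₀ / N₁) * (t₁ / N₀) =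
      g₀ * (c - c') * (v / N₂) * (w / N₃) := by
  have h : c * t₀ * E₁ - c' * E₀ * t₁ = c * g₀ * (A⁻¹ - A ^ 2) * (v * w) := by
    rw [hE₀, hE₁, hX₂, hc]
    field_simp
    ring
  have e : c * (t₀ / N₀) * (E₁ / N₁) - c' * (E₀ / N₁) * (t₁ / N₀) =
      (c * t₀ * E₁ - c' * E₀ * t₁) / (N₀ * N₁) := by
    field_simp
  rw [e, h, hc]
  field_simp
  linear_combination (c * g₀ * v * w * (A - 1)) * hN

/-! ### The bilinear equations -/

/-- The bilinear equation of a translation that acts on the indeterminates with indices `u i` as a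
reflection, at a parameter point `α`. -/
theorem bilinear_at {ell : Fun →+* Fun} (hdiv : ∀ F G, ell (F / G) = ell F / ell G)
    {A c c' n₀ n₁ n₂ n₃ : Param → ℂ} {g : ZMod 3 → Param → ℂ} {u v w : ZMod 3 → Fin 9}
    (htau : ∀ i, ell (tau (u i)) = reflFormula A g u v w i)
    (hcoeff : ell (ofCoeff n₀) = ofCoeff n₁) (i : ZMod 3) (α : Param)
    (hA : A α ≠ 0) (hc : c' α = c α * A α)
    (h₀ : n₀ α ≠ 0) (h₁ : n₁ α ≠ 0) (h₂ : n₂ α ≠ 0) (h₃ : n₃ α ≠ 0)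
    (hn : A α * (n₀ α * n₁ α) = (1 + A α + A α ^ 2) * (n₂ α * n₃ α)) :
    (ofCoeff c * (tau (u i) / ofCoeff n₀) * ell (tau (u (i + 1)) / ofCoeff n₀) -
        ofCoeff c' * ell (tau (u i) / ofCoeff n₀) * (tau (u (i + 1)) / ofCoeff n₀)) α =
      (ofCoeff (g i) * ofCoeff (fun β => c β - c' β) * (tau (v (i + 2)) / ofCoeff n₂) *
        (tau (w (i + 2)) / ofCoeff n₃)) α := by
  have hi₂ : i + 1 + 1 = i + 2 := by ring
  have hi₃ : i + 1 + 2 = i := by revert i; decide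
  have hi₄ : i + 2 + 1 = i := by revert i; decide
  have hne {x : ℂ} (hx : x ≠ 0) : algebraMap ℂ TauField x ≠ 0 :=
    (map_ne_zero (algebraMap ℂ TauField)).2 hx
  rw [hdiv, hdiv, hcoeff, htau, htau]
  simp only [reflFormula, hi₂, hi₃, Pi.sub_apply, Pi.mul_apply, Pi.div_apply, Pi.add_apply,
    ofCoeff, tau, map_sub, map_inv₀]
  refine bilinear_identity (hne hA) (tauVar_ne_zero _) (tauVar_ne_zero _)
    (tauVar_ne_zero (u (i + 2))) (hne h₀) (hne h₁) (hne h₂) (hne h₃) ?_ rfl rfl rfl ?_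
  · rw [hc, map_mul]
  · simpa only [map_mul, map_add, map_pow, map_one] using congrArg (algebraMap ℂ TauField) hn

theorem NormRegular.norm_ne_zero {q a b : ℂ} (h : NormRegular q a b) : norm q a b ≠ 0 :=
  div_ne_zero h.1 h.2

theorem ell1_tau_uIdx (i : ZMod 3) :
    ell1 (tau (uIdx i)) = reflFormula (fun α => (α 3 : ℂ) ^ 3) gamma uIdx vIdx wIdx i := by
  simp only [ell1, word_cons, word_nil, r258_tau_uIdx, r369_tau_uIdx, r147_tau_uIdx]

theorem ell2_tau_vIdx (i : ZMod 3) : ell2 (tau (vIdx i)) =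
    reflFormula (fun α => (param246 α 3 : ℂ) ^ 3) delta vIdx wIdx uIdx i := by
  simp only [ell2, word_cons, word_nil, r147_tau_vIdx, r369_tau_vIdx, r258_tau_vIdx, reflFormula,
    gamma_param246, mul_right_comm _ (tau (uIdx _)) (tau (wIdx _))]

theorem ell3_tau_wIdx (i : ZMod 3) : ell3 (tau (wIdx i)) =
    reflFormula (fun α => (param246 (param015 α) 3 : ℂ) ^ 3) epsilon wIdx uIdx vIdx i := by
  simp only [ell3, word_cons, word_nil, r147_tau_wIdx, r258_tau_wIdx, r369_tau_wIdx, reflFormula,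
    gamma_param246, delta_param015]

theorem ell1_norm (f : ℂ → ℂ → ℂ → ℂ) : ell1 (ofCoeff fun α => f (qRoot α) (a α) (b α)) =
    ofCoeff fun α => f (qRoot α) (a α) ((q α)⁻¹ * b α) := by
  rw [ell1_ofCoeff]
  congr 1
  funext α
  have ha := a_ne_zero α
  have hb := b_ne_zero α
  have hq := qRoot_ne_zero α
  simp only [qRoot_param147, qRoot_param258, qRoot_param369, a_param147, a_param258, a_param369,
    b_param147, b_param258, b_param369, q]
  congr 1
  field_simp

theorem ell2_norm (f : ℂ → ℂ → ℂ → ℂ) : ell2 (ofCoeff fun α => f (qRoot α) (a α) (b α)) =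
    ofCoeff fun α => f (qRoot α) ((q α)⁻¹ * a α) (q α * b α) := by
  rw [ell2_ofCoeff]
  congr 1
  funext α
  have ha := a_ne_zero α
  have hb := b_ne_zero α
  have hq := qRoot_ne_zero α
  simp only [qRoot_param147, qRoot_param258, qRoot_param369, a_param147, a_param258, a_param369,
    b_param147, b_param258, b_param369, q]
  congr 1 <;> field_simp

theorem ell3_norm (f : ℂ → ℂ → ℂ → ℂ) : ell3 (ofCoeff fun α => f (qRoot α) (a α) (b α)) =
    ofCoeff fun α => f (qRoot α) (q α * a α) (b α) := by
  rw [ell3_ofCoeff]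
  congr 1
  funext α
  have ha := a_ne_zero α
  have hb := b_ne_zero α
  have hq := qRoot_ne_zero α
  simp only [qRoot_param147, qRoot_param258, qRoot_param369, a_param147, a_param258, a_param369,
    b_param147, b_param258, b_param369, q]
  congr 1 <;> field_simp

theorem normNum_eq_and_normDen_eq {q a b u₁ u₂ u₃ : ℂ} (ha : a ≠ 0) (hb : b ≠ 0)
    (h₁ : u₁ = a / b) (h₂ : u₂ = a * b ^ 2) (h₃ : u₃ = 1 / (a ^ 2 * b)) :
    normNum q a b = factorNum q u₁ * factorNum q u₂ * factorNum q u₃ ∧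
      normDen q a b = factorDen q u₁ * factorDen q u₂ * factorDen q u₃ :=
  ⟨normNum_eq ha hb h₁ h₂ h₃, normDen_eq ha hb h₁ h₂ h₃⟩

theorem norm_ratio_U {r a b : ℂ} (hr : r ≠ 0) (ha : a ≠ 0) (hb : b ≠ 0) (hq : ‖r ^ 3‖ < 1)
    (h₀ : RegularU r a b) (h₁ : RegularU r (a) ((r ^ 3)⁻¹ * b)) (h₂ : RegularV r a b)
    (h₃ : RegularW r a b) :
    r ^ 3 / (a * b ^ 2) * (norm (r ^ 3) (a) (b) * norm (r ^ 3) (a) (((r ^ 3)⁻¹ * b))) =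
      (1 + r ^ 3 / (a * b ^ 2) + (r ^ 3 / (a * b ^ 2)) ^ 2) *
        (norm (r ^ 3) (r * a) ((r ^ 2)⁻¹ * b) * norm (r ^ 3) (r⁻¹ * a) (r⁻¹ * b)) := by
  have hr' := pow_ne_zero 3 hr
  have e₀ := normNum_eq_and_normDen_eq (q := r ^ 3) (a := a) (b := b)
    (u₁ := a / b) (u₂ := r ^ 3 * (a * b ^ 2 / r ^ 3)) (u₃ := 1 / (a ^ 2 * b))
    ha hb (by field_simp) (by field_simp) (by field_simp)
  have e₁ := normNum_eq_and_normDen_eq (q := r ^ 3) (a := a) (b := ((r ^ 3)⁻¹ * b))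
    (u₁ := r ^ 3 * a / b) (u₂ := (a * b ^ 2 / r ^ 3) / r ^ 3) (u₃ := r ^ 3 / (a ^ 2 * b))
    ha (by simp [hb, hr]) (by field_simp) (by field_simp) (by field_simp)
  have e₂ := normNum_eq_and_normDen_eq (q := r ^ 3) (a := r * a) (b := (r ^ 2)⁻¹ * b)
    (u₁ := r ^ 3 * a / b) (u₂ := a * b ^ 2 / r ^ 3) (u₃ := 1 / (a ^ 2 * b))
    (by simp [ha, hr]) (by simp [hb, hr]) (by field_simp) (by field_simp) (by field_simp)
  have e₃ := normNum_eq_and_normDen_eq (q := r ^ 3) (a := r⁻¹ * a) (b := r⁻¹ * b)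
    (u₁ := a / b) (u₂ := a * b ^ 2 / r ^ 3) (u₃ := r ^ 3 / (a ^ 2 * b))
    (by simp [ha, hr]) (by simp [hb, hr]) (by field_simp) (by field_simp) (by field_simp)
  refine factor_ratio hr' hq (u := a * b ^ 2 / r ^ 3) (v := 1 / (a ^ 2 * b)) (v' := r ^ 3 / (a ^ 2 * b))
    (w := a / b) (w' := r ^ 3 * a / b) (by simp [ha, hb, hr]) (by simp) (e₀.1.trans ?_) (e₁.1.trans ?_)
    (e₂.1.trans ?_) (e₃.1.trans ?_) (e₀.2.trans ?_) (e₁.2.trans ?_) (e₂.2.trans ?_)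
    (e₃.2.trans ?_) h₀.2 h₁.2 h₂.2 h₃.2
  all_goals ring

theorem norm_ratio_V {r a b : ℂ} (hr : r ≠ 0) (ha : a ≠ 0) (hb : b ≠ 0) (hq : ‖r ^ 3‖ < 1)
    (h₀ : RegularV r a b) (h₁ : RegularV r ((r ^ 3)⁻¹ * a) (r ^ 3 * b)) (h₂ : RegularW r a b)
    (h₃ : RegularU r a b) :
    b / a * (norm (r ^ 3) (r * a) ((r ^ 2)⁻¹ * b) *
        norm (r ^ 3) (r * ((r ^ 3)⁻¹ * a)) ((r ^ 2)⁻¹ * (r ^ 3 * b))) =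
      (1 + b / a + (b / a) ^ 2) *
        (norm (r ^ 3) (r⁻¹ * a) (r⁻¹ * b) * norm (r ^ 3) (a) (b)) := by
  have hr' := pow_ne_zero 3 hr
  have e₀ := normNum_eq_and_normDen_eq (q := r ^ 3) (a := r * a) (b := (r ^ 2)⁻¹ * b)
    (u₁ := r ^ 3 * (a / b)) (u₂ := a * b ^ 2 / r ^ 3) (u₃ := 1 / (a ^ 2 * b))
    (by simp [ha, hr]) (by simp [hb, hr]) (by field_simp) (by field_simp) (by field_simp)
  have e₁ := normNum_eq_and_normDen_eq (q := r ^ 3) (a := r * ((r ^ 3)⁻¹ * a))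
    (b := (r ^ 2)⁻¹ * (r ^ 3 * b))
    (u₁ := (a / b) / r ^ 3) (u₂ := a * b ^ 2) (u₃ := r ^ 3 / (a ^ 2 * b))
    (by simp [ha, hr]) (by simp [hb, hr]) (by field_simp) (by field_simp) (by field_simp)
  have e₂ := normNum_eq_and_normDen_eq (q := r ^ 3) (a := r⁻¹ * a) (b := r⁻¹ * b)
    (u₁ := a / b) (u₂ := a * b ^ 2 / r ^ 3) (u₃ := r ^ 3 / (a ^ 2 * b))
    (by simp [ha, hr]) (by simp [hb, hr]) (by field_simp) (by field_simp) (by field_simp)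
  have e₃ := normNum_eq_and_normDen_eq (q := r ^ 3) (a := a) (b := b)
    (u₁ := a / b) (u₂ := a * b ^ 2) (u₃ := 1 / (a ^ 2 * b))
    ha hb (by field_simp) (by field_simp) (by field_simp)
  refine factor_ratio hr' hq (u := a / b) (v := a * b ^ 2 / r ^ 3) (v' := a * b ^ 2)
    (w := 1 / (a ^ 2 * b)) (w' := r ^ 3 / (a ^ 2 * b)) (by simp [ha, hb]) (by simp) (e₀.1.trans ?_) (e₁.1.trans ?_)
    (e₂.1.trans ?_) (e₃.1.trans ?_) (e₀.2.trans ?_) (e₁.2.trans ?_) (e₂.2.trans ?_)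
    (e₃.2.trans ?_) h₀.2 h₁.2 h₂.2 h₃.2
  all_goals ring

theorem norm_ratio_W {r a b : ℂ} (hr : r ≠ 0) (ha : a ≠ 0) (hb : b ≠ 0) (hq : ‖r ^ 3‖ < 1)
    (h₀ : RegularW r a b) (h₁ : RegularW r (r ^ 3 * a) (b)) (h₂ : RegularU r a b)
    (h₃ : RegularV r a b) :
    a ^ 2 * b * (norm (r ^ 3) (r⁻¹ * a) (r⁻¹ * b) * norm (r ^ 3) (r⁻¹ * (r ^ 3 * a)) (r⁻¹ * b)) =
      (1 + a ^ 2 * b + (a ^ 2 * b) ^ 2) *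
        (norm (r ^ 3) (a) (b) * norm (r ^ 3) (r * a) ((r ^ 2)⁻¹ * b)) := by
  have hr' := pow_ne_zero 3 hr
  have e₀ := normNum_eq_and_normDen_eq (q := r ^ 3) (a := r⁻¹ * a) (b := r⁻¹ * b)
    (u₁ := a / b) (u₂ := a * b ^ 2 / r ^ 3) (u₃ := r ^ 3 * (1 / (a ^ 2 * b)))
    (by simp [ha, hr]) (by simp [hb, hr]) (by field_simp) (by field_simp) (by field_simp)
  have e₁ := normNum_eq_and_normDen_eq (q := r ^ 3) (a := r⁻¹ * (r ^ 3 * a)) (b := r⁻¹ * b)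
    (u₁ := r ^ 3 * a / b) (u₂ := a * b ^ 2) (u₃ := (1 / (a ^ 2 * b)) / r ^ 3)
    (by simp [ha, hr]) (by simp [hb, hr]) (by field_simp) (by field_simp) (by field_simp)
  have e₂ := normNum_eq_and_normDen_eq (q := r ^ 3) (a := a) (b := b)
    (u₁ := a / b) (u₂ := a * b ^ 2) (u₃ := 1 / (a ^ 2 * b))
    ha hb (by field_simp) (by field_simp) (by field_simp)
  have e₃ := normNum_eq_and_normDen_eq (q := r ^ 3) (a := r * a) (b := (r ^ 2)⁻¹ * b)
    (u₁ := r ^ 3 * a / b) (u₂ := a * b ^ 2 / r ^ 3) (u₃ := 1 / (a ^ 2 * b))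
    (by simp [ha, hr]) (by simp [hb, hr]) (by field_simp) (by field_simp) (by field_simp)
  refine factor_ratio hr' hq (u := 1 / (a ^ 2 * b)) (v := a / b) (v' := r ^ 3 * a / b)
    (w := a * b ^ 2 / r ^ 3) (w' := a * b ^ 2) (by simp [ha, hb]) (by simp) (e₀.1.trans ?_) (e₁.1.trans ?_)
    (e₂.1.trans ?_) (e₃.1.trans ?_) (e₀.2.trans ?_) (e₁.2.trans ?_) (e₂.2.trans ?_)
    (e₃.2.trans ?_) h₀.2 h₁.2 h₂.2 h₃.2
  all_goals ring

theorem U_eq (i : ZMod 3) : U i =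
    tau (uIdx i) / ofCoeff fun α => norm (qRoot α ^ 3) (a α) (b α) := rfl

theorem V_eq (i : ZMod 3) : V i =
    tau (vIdx i) / ofCoeff fun α => norm (qRoot α ^ 3) (qRoot α * a α) ((qRoot α ^ 2)⁻¹ * b α) :=
  rfl

theorem W_eq (i : ZMod 3) : W i =
    tau (wIdx i) / ofCoeff fun α => norm (qRoot α ^ 3) ((qRoot α)⁻¹ * a α) ((qRoot α)⁻¹ * b α) :=
  rfl

end QPE6

theorem mainTheorem6 (i : ZMod 3) (α : QPE6.Param) (hq : ‖QPE6.q α‖ < 1)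
    (hU : QPE6.RegularU (QPE6.qRoot α) (QPE6.a α) (QPE6.b α))
    (hV : QPE6.RegularV (QPE6.qRoot α) (QPE6.a α) (QPE6.b α))
    (hW : QPE6.RegularW (QPE6.qRoot α) (QPE6.a α) (QPE6.b α)) :
    (QPE6.RegularU (QPE6.qRoot α) (QPE6.a α) ((QPE6.q α)⁻¹ * QPE6.b α) →
      (QPE6.ofCoeff (fun β => QPE6.a β * QPE6.b β) * QPE6.U i * QPE6.ell1 (QPE6.U (i + 1)) -
        QPE6.ofCoeff (fun β => QPE6.q β / QPE6.b β) * QPE6.ell1 (QPE6.U i) * QPE6.U (i + 1)) α =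
      (QPE6.ofCoeff (QPE6.gamma i) *
        QPE6.ofCoeff (fun β => QPE6.a β * QPE6.b β - QPE6.q β / QPE6.b β) *
        QPE6.V (i + 2) * QPE6.W (i + 2)) α) ∧
    (QPE6.RegularV (QPE6.qRoot α) ((QPE6.q α)⁻¹ * QPE6.a α) (QPE6.q α * QPE6.b α) →
      (QPE6.ofCoeff (fun β => 1 / QPE6.b β) * QPE6.V i * QPE6.ell2 (QPE6.V (i + 1)) -
        QPE6.ofCoeff (fun β => 1 / QPE6.a β) * QPE6.ell2 (QPE6.V i) * QPE6.V (i + 1)) α =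
      (QPE6.ofCoeff (QPE6.delta i) *
        QPE6.ofCoeff (fun β => 1 / QPE6.b β - 1 / QPE6.a β) *
        QPE6.W (i + 2) * QPE6.U (i + 2)) α) ∧
    (QPE6.RegularW (QPE6.qRoot α) (QPE6.q α * QPE6.a α) (QPE6.b α) →
      (QPE6.ofCoeff (fun β => 1 / QPE6.a β) * QPE6.W i * QPE6.ell3 (QPE6.W (i + 1)) -
        QPE6.ofCoeff (fun β => QPE6.a β * QPE6.b β) * QPE6.ell3 (QPE6.W i) * QPE6.W (i + 1)) α =
      (QPE6.ofCoeff (QPE6.epsilon i) *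
        QPE6.ofCoeff (fun β => 1 / QPE6.a β - QPE6.a β * QPE6.b β) *
        QPE6.U (i + 2) * QPE6.V (i + 2)) α) := by
  have hr := QPE6.qRoot_ne_zero α
  have ha := QPE6.a_ne_zero α
  have hb := QPE6.b_ne_zero α
  simp only [QPE6.U_eq, QPE6.V_eq, QPE6.W_eq]
  refine ⟨fun h => ?_, fun h => ?_, fun h => ?_⟩
  · refine QPE6.bilinear_at QPE6.ell1_div QPE6.ell1_tau_uIdx
      (QPE6.ell1_norm fun r a b => QPE6.norm (r ^ 3) a b) i α ?_ ?_
      hU.norm_ne_zero h.norm_ne_zero hV.norm_ne_zero hW.norm_ne_zero ?_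
    · simp
    · simp only [QPE6.a147_eq]
      field_simp
    · simp only [QPE6.a147_eq]
      exact QPE6.norm_ratio_U hr ha hb hq hU h hV hW
  · refine QPE6.bilinear_at QPE6.ell2_div QPE6.ell2_tau_vIdx
      (QPE6.ell2_norm fun r a b => QPE6.norm (r ^ 3) (r * a) ((r ^ 2)⁻¹ * b)) i α ?_ ?_
      hV.norm_ne_zero h.norm_ne_zero hW.norm_ne_zero hU.norm_ne_zero ?_
    · simp
    · simp only [QPE6.a258_eq]
      field_simp
    · simp only [QPE6.a258_eq]
      exact QPE6.norm_ratio_V hr ha hb hq hV h hW hU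
  · refine QPE6.bilinear_at QPE6.ell3_div QPE6.ell3_tau_wIdx
      (QPE6.ell3_norm fun r a b => QPE6.norm (r ^ 3) (r⁻¹ * a) (r⁻¹ * b)) i α ?_ ?_
      hW.norm_ne_zero h.norm_ne_zero hU.norm_ne_zero hV.norm_ne_zero ?_
    · simp
    · simp only [QPE6.a369_eq]
      field_simp
    · simp only [QPE6.a369_eq]
      exact QPE6.norm_ratio_W hr ha hb hq hW h hU hV
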